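/- Let $Y\in\mathbb{C}^{M\times T}$, $\lambda_1,\lambda_2\ge 0$ and $\mu\in\mathbb{R}\setminus\{0\}$. For $Z,V\in\mathbb{C}^{M\times T}$ put $$f(Z,V)=\tfrac12\|Y-Z-V\|_F^2+\lambda_1\|[Z,\mu I]\|_*+\lambda_2\|[V,\mu\mathbf 1]\|_{2,1},$$ where $\|\cdot\|_F$ is the Frobenius norm, $\|\cdot\|_*$ is the nuclear norm (sum of the singular values), $\|\cdot\|_{2,1}$ is the sum of the Euclidean norms of the rows, $I$ is the $M\times M$ identity matrix and $\mathbf 1$ is the all-ones column vector of length $M$. Put $$P(Z)=(ZZ^{\mathrm H}+\mu^2 I)^{-1/2},\qquad Q(V)=\mathrm{diag}\Big(\big(\|V_{i,:}\|_2^2+\mu^2\big)^{-1/2}\Big)_{i=1}^{M}.$$ Let $\{(Z_k,V_k)\}_{k\ge 0}$ be generated, from an arbitrary initial pair $(Z_0,V_0)$ of matrices in $\mathbb{C}^{M\times T}$, by the iteratively reweighted least squares (IRLS) iteration $$Z_{k+1}=(I+\lambda_1P(Z_k))^{-1}(Y-V_k),\qquad V_{k+1}=(I+\lambda_2Q(V_k))^{-1}(Y-Z_{k+1}).$$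 Then every limit point $(Z_*,V_*)$ of the sequence (that is, the limit of some subsequence) is a stationary point of the problem $\min_{Z,V}f(Z,V)$: the (real) Fréchet derivative of $f$ at $(Z_*,V_*)$ exists and is zero, and the Karush–Kuhn–Tucker (KKT) equations $$(I+\lambda_1P(Z_*))Z_*-Y+V_*=0,\qquad (I+\lambda_2Q(V_*))V_*-Y+Z_*=0$$ hold, equivalently the fixed-point equations $Z_*=(I+\lambda_1P(Z_*))^{-1}(Y-V_*)$ and $V_*=(I+\lambda_2Q(V_*))^{-1}(Y-Z_*)$. Moreover, $(Z_*,V_*)$ is a global minimizer of $f$ over $\mathbb{C}^{M\times T}\times\mathbb{C}^{M\times T}$. -/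

import Mathlib

open Filter Topology
open scoped Matrix

noncomputable section

namespace NoisyIRLS

/-- Squared Frobenius norm `‖A‖_F²` of a complex matrix. -/
def frobeniusSq {m n : Type*} [Fintype m] [Fintype n] (A : Matrix m n ℂ) : ℝ :=
  ∑ i, ∑ j, ‖A i j‖ ^ 2

/-- Nuclear norm `‖A‖_*`: the sum of the singular values of `A`, that is, of the square roots
of the eigenvalues (with multiplicity) of the positive semidefinite matrix `A Aᴴ`. -/
def nuclearNorm {m n : Type*} [Fintype m] [DecidableEq m] [Fintype n] (A : Matrix m n ℂ) : ℝ :=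
  ∑ i, √((Matrix.isHermitian_mul_conjTranspose_self A).eigenvalues i)

/-- Euclidean norm `‖A_{i,:}‖₂` of the `i`-th row. -/
def rowNorm {m n : Type*} [Fintype n] (A : Matrix m n ℂ) (i : m) : ℝ :=
  √(∑ j, ‖A i j‖ ^ 2)

/-- Mixed norm `‖A‖_{2,1}`: the sum of the Euclidean norms of the rows. -/
def l21Norm {m n : Type*} [Fintype m] [Fintype n] (A : Matrix m n ℂ) : ℝ :=
  ∑ i, rowNorm A i

variable {M T : ℕ}

/-- The block matrix `[Z, μ I]`, with `I` the `M × M` identity. -/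
def augId (μ : ℝ) (Z : Matrix (Fin M) (Fin T) ℂ) : Matrix (Fin M) (Fin T ⊕ Fin M) ℂ :=
  Matrix.fromCols Z ((μ : ℂ) • (1 : Matrix (Fin M) (Fin M) ℂ))

/-- The block matrix `[V, μ 1]`, with `1` the all-ones column of length `M`. -/
def augOnes (μ : ℝ) (V : Matrix (Fin M) (Fin T) ℂ) : Matrix (Fin M) (Fin T ⊕ Unit) ℂ :=
  Matrix.fromCols V (Matrix.of fun _ _ => (μ : ℂ))

/-- The smoothed objective
`f(Z, V) = ½ ‖Y - Z - V‖_F² + λ₁ ‖[Z, μ I]‖_* + λ₂ ‖[V, μ 1]‖_{2,1}`. -/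
def objective (Y : Matrix (Fin M) (Fin T) ℂ) (lam₁ lam₂ μ : ℝ)
    (W : Matrix (Fin M) (Fin T) ℂ × Matrix (Fin M) (Fin T) ℂ) : ℝ :=
  1 / 2 * frobeniusSq (Y - W.1 - W.2) + lam₁ * nuclearNorm (augId μ W.1)
    + lam₂ * l21Norm (augOnes μ W.2)

/-- `P(Z) = (Z Zᴴ + μ² I)^{-1/2}`, through the functional calculus of Hermitian matrices. -/
def weightP (μ : ℝ) (Z : Matrix (Fin M) (Fin T) ℂ) : Matrix (Fin M) (Fin M) ℂ :=
  cfc (fun x : ℝ => x ^ (-(1 / 2) : ℝ))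
    (Z * Zᴴ + ((μ : ℂ) ^ 2) • (1 : Matrix (Fin M) (Fin M) ℂ))

/-- `Q(V)`, the diagonal matrix with entries `1 / √(‖V_{i,:}‖₂² + μ²)`. -/
def weightQ (μ : ℝ) (V : Matrix (Fin M) (Fin T) ℂ) : Matrix (Fin M) (Fin M) ℂ :=
  Matrix.diagonal fun i => ((1 / √(rowNorm V i ^ 2 + μ ^ 2) : ℝ) : ℂ)

/-- `(Z k, V k)` is generated by the noisy-case IRLS procedure, from an arbitrary initial pair. -/
def IsIRLSSequence (Y : Matrix (Fin M) (Fin T) ℂ) (lam₁ lam₂ μ : ℝ)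
    (Z V : ℕ → Matrix (Fin M) (Fin T) ℂ) : Prop :=
  ∀ k, Z (k + 1) = (1 + (lam₁ : ℂ) • weightP μ (Z k))⁻¹ * (Y - V k) ∧
    V (k + 1) = (1 + (lam₂ : ℂ) • weightQ μ (V k))⁻¹ * (Y - Z (k + 1))

end NoisyIRLS

end

/-! IRLS is alternating majorization-minimization. Each penalty `g` (smoothed nuclear norm, smoothed
row norm) is convex with gradient `W(Z) Z`, and lies below the quadratic that touches it at `Z` and
has Hessian `W(Z)`. A half step minimizes the exact data term plus this quadratic, so it lowers the
objective by at least half the squared step length (`descent`). As the objective is nonnegative,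
steps tend to zero (`tendsto_step`). Along a filter converging to a limit point, old and new
iterates therefore share a limit. The equation of each half step expresses the gradient of the
penalty at the old iterate through convergent quantities, so the subgradient inequality passes to
the limit (`subgradient_of_tendsto`); uniform boundedness of `W` replaces its continuity. The two
inequalities give global optimality by convexity. The quadratic upper bounds identify the
subgradients with `W(Z) Z`, which is KKT, and then show that the objective grows at most
quadratically at its minimizer, so its derivative there is zero. -/

namespace NoisyIRLS

open scoped ComplexOrder

/-! ### Real inner product and Frobenius norm. -/

section RealInner

variable {m n : Type*} [Fintype m] [Fintype n]

/-- The real inner product `Re tr(A Bᴴ)` on complex matrices. -/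
def reInner (A B : Matrix m n ℂ) : ℝ := (A * Bᴴ).trace.re

theorem reInner_add_left (A B C : Matrix m n ℂ) :
    reInner (A + B) C = reInner A C + reInner B C := by
  simp [reInner, Matrix.add_mul]

theorem reInner_sub_left (A B C : Matrix m n ℂ) :
    reInner (A - B) C = reInner A C - reInner B C := by
  simp [reInner, Matrix.sub_mul]

theorem reInner_smul_left (r : ℝ) (A B : Matrix m n ℂ) :
    reInner ((r : ℂ) • A) B = r * reInner A B := by
  simp [reInner]

theorem reInner_comm (A B : Matrix m n ℂ) : reInner A B = reInner B A := by
  have h : (A * Bᴴ)ᴴ = B * Aᴴ := by simp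
  rw [reInner, reInner, ← h, Matrix.trace_conjTranspose]
  simp

theorem reInner_add_right (A B C : Matrix m n ℂ) :
    reInner A (B + C) = reInner A B + reInner A C := by
  simp [reInner, Matrix.mul_add]

theorem reInner_neg_right (A B : Matrix m n ℂ) : reInner A (-B) = -reInner A B := by
  simp [reInner]

theorem reInner_smul_right (r : ℝ) (A B : Matrix m n ℂ) :
    reInner A ((r : ℂ) • B) = r * reInner A B := by
  rw [reInner_comm, reInner_smul_left, reInner_comm]

theorem reInner_eq_sum (A B : Matrix m n ℂ) :
    reInner A B = ∑ i, ∑ j, ((A i j).re * (B i j).re + (A i j).im * (B i j).im) := by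
  simp [reInner, Matrix.trace, Matrix.mul_apply]

theorem reInner_self (A : Matrix m n ℂ) : reInner A A = frobeniusSq A := by
  simp only [reInner_eq_sum, frobeniusSq, Complex.sq_norm, Complex.normSq_apply]

theorem reInner_mul_left {k : Type*} [Fintype k] (W : Matrix m k ℂ) (A : Matrix k n ℂ)
    (B : Matrix m n ℂ) :
    reInner (W * A) B = reInner A (Wᴴ * B) := by
  rw [reInner, reInner, Matrix.conjTranspose_mul, Matrix.conjTranspose_conjTranspose,
    Matrix.mul_assoc, Matrix.trace_mul_comm, Matrix.mul_assoc]

theorem reInner_mul_self_nonneg {W : Matrix m m ℂ} (hW : W.PosSemidef) (A : Matrix m n ℂ) :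
    0 ≤ reInner (W * A) A :=
  (Complex.nonneg_iff.mp (hW.conjTranspose_mul_mul_same A).trace_nonneg).1.trans_eq <| by
    rw [Matrix.mul_assoc, Matrix.trace_mul_comm, reInner]

theorem frobeniusSq_nonneg (A : Matrix m n ℂ) : 0 ≤ frobeniusSq A :=
  Finset.sum_nonneg fun _ _ => Finset.sum_nonneg fun _ _ => by positivity

theorem frobeniusSq_add (A B : Matrix m n ℂ) :
    frobeniusSq (A + B) = frobeniusSq A + 2 * reInner A B + frobeniusSq B := by
  simp only [← reInner_self, reInner_add_left, reInner_add_right, reInner_comm B A]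
  ring

theorem frobeniusSq_neg (A : Matrix m n ℂ) : frobeniusSq (-A) = frobeniusSq A := by
  simp [frobeniusSq]

theorem two_mul_reInner_le (A B : Matrix m n ℂ) :
    2 * reInner A B ≤ frobeniusSq A + frobeniusSq B := by
  have h := frobeniusSq_nonneg (A + -B)
  rw [frobeniusSq_add, frobeniusSq_neg, reInner_neg_right] at h
  linarith

theorem norm_sq_le_frobeniusSq (A : Matrix m n ℂ) (i : m) (j : n) :
    ‖A i j‖ ^ 2 ≤ frobeniusSq A :=
  (Finset.single_le_sum (f := fun j => ‖A i j‖ ^ 2) (fun _ _ => by positivity)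
      (Finset.mem_univ j)).trans
    (Finset.single_le_sum (f := fun i => ∑ j, ‖A i j‖ ^ 2)
      (fun _ _ => Finset.sum_nonneg fun _ _ => by positivity) (Finset.mem_univ i))

theorem frobeniusSq_eq_zero {A : Matrix m n ℂ} (h : frobeniusSq A ≤ 0) : A = 0 := by
  ext i j
  simpa using pow_eq_zero_iff (two_ne_zero) |>.mp
    (le_antisymm ((norm_sq_le_frobeniusSq A i j).trans h) (by positivity))

theorem continuous_reInner :
    Continuous fun p : Matrix m n ℂ × Matrix m n ℂ => reInner p.1 p.2 := by
  unfold reInner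
  fun_prop

theorem continuous_frobeniusSq : Continuous (frobeniusSq : Matrix m n ℂ → ℝ) := by
  have h : Continuous fun A : Matrix m n ℂ => reInner A A := by
    unfold reInner
    fun_prop
  exact h.congr reInner_self

theorem tendsto_zero_of_frobeniusSq {ι : Type*} {l : Filter ι} {A : ι → Matrix m n ℂ}
    (h : Tendsto (fun k => frobeniusSq (A k)) l (𝓝 0)) : Tendsto A l (𝓝 0) := by
  suffices H : ∀ i j, Tendsto (fun k => A k i j) l (𝓝 0) from
    tendsto_pi_nhds.mpr fun i => tendsto_pi_nhds.mpr fun j => H i j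
  intro i j
  have h2 : Tendsto (fun k => ‖A k i j‖ ^ 2) l (𝓝 0) :=
    squeeze_zero (fun _ => by positivity) (fun k => norm_sq_le_frobeniusSq (A k) i j) h
  have h3 := h2.sqrt
  simp only [Real.sqrt_sq (norm_nonneg _), Real.sqrt_zero] at h3
  exact tendsto_zero_iff_norm_tendsto_zero.mpr h3

/-- A linear functional bounded by a multiple of the squared norm vanishes. -/
theorem eq_zero_of_reInner_le {A : Matrix m n ℂ} {c : ℝ}
    (h : ∀ D : Matrix m n ℂ, reInner A D ≤ c * frobeniusSq D) : A = 0 := by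
  apply frobeniusSq_eq_zero
  have key : ∀ t : ℝ, t * frobeniusSq A ≤ c * t ^ 2 * frobeniusSq A := fun t => by
    have := h ((t : ℂ) • A)
    rw [← reInner_self ((t : ℂ) • A), reInner_smul_right, reInner_smul_right,
      reInner_smul_left, reInner_self] at this
    linarith
  have hA := frobeniusSq_nonneg A
  -- Testing with `t • A` for this `t` gives `c * t < 1`, so the linear term would beat the
  -- quadratic one.
  have ht : 0 < 1 / (|c| + 1) := by positivity
  have h1 := key (1 / (|c| + 1))
  have h2 : c * (1 / (|c| + 1)) < 1 := by
    rw [mul_one_div, div_lt_one (by positivity)]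
    linarith [le_abs_self c]
  by_contra! hpos
  have h3 : 1 / (|c| + 1) * frobeniusSq A * (1 - c * (1 / (|c| + 1))) > 0 := by
    have : 0 < 1 - c * (1 / (|c| + 1)) := by linarith
    positivity
  nlinarith

end RealInner

/-! ### One reweighted least squares step for an abstract penalty. -/

variable {M T : ℕ}

/-- `g` is convex with gradient `W(Z) Z` at `Z`, and is majorized at each point by a quadratic
function with Hessian `D ↦ W(Z) D`, where the weights `W` are positive semidefinite and
uniformly bounded. -/
structure IsReweightable (g : Matrix (Fin M) (Fin T) ℂ → ℝ)
    (W : Matrix (Fin M) (Fin T) ℂ → Matrix (Fin M) (Fin M) ℂ) (c : ℝ) : Prop where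
  nonneg : ∀ Z, 0 ≤ g Z
  posSemidef : ∀ Z, (W Z).PosSemidef
  lower : ∀ Z D, g Z + reInner (W Z * Z) D ≤ g (Z + D)
  upper : ∀ Z D, g (Z + D) ≤ g Z + reInner (W Z * Z) D + 1 / 2 * reInner (W Z * D) D
  bound : ∀ Z (D : Matrix (Fin M) (Fin T) ℂ), frobeniusSq (W Z * D) ≤ c * frobeniusSq D

theorem isUnit_one_add_smul {W : Matrix (Fin M) (Fin M) ℂ} (hW : W.PosSemidef) {lam : ℝ}
    (hlam : 0 ≤ lam) : IsUnit (1 + (lam : ℂ) • W).det := by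
  rw [← Matrix.isUnit_iff_isUnit_det]
  exact (Matrix.PosDef.one.add_posSemidef
    (hW.smul (Complex.zero_le_real.mpr hlam))).isUnit

namespace IsReweightable

variable {g : Matrix (Fin M) (Fin T) ℂ → ℝ}
  {W : Matrix (Fin M) (Fin T) ℂ → Matrix (Fin M) (Fin M) ℂ} {c lam : ℝ}

theorem eq_inv_mul_iff (h : IsReweightable g W c) (hlam : 0 ≤ lam)
    {Z A B : Matrix (Fin M) (Fin T) ℂ} :
    A = (1 + (lam : ℂ) • W Z)⁻¹ * B ↔ (1 + (lam : ℂ) • W Z) * A = B := by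
  have hu := isUnit_one_add_smul (h.posSemidef Z) hlam
  constructor
  · rintro rfl
    exact Matrix.mul_nonsing_inv_cancel_left _ _ hu
  · rintro rfl
    exact (Matrix.nonsing_inv_mul_cancel_left _ _ hu).symm

/-- Sufficient decrease of one reweighted least squares step. -/
theorem descent (h : IsReweightable g W c) (hlam : 0 ≤ lam)
    {Z A B : Matrix (Fin M) (Fin T) ℂ} (hA : A = (1 + (lam : ℂ) • W Z)⁻¹ * B) :
    1 / 2 * frobeniusSq (B - A) + lam * g A + 1 / 2 * frobeniusSq (A - Z)
      ≤ 1 / 2 * frobeniusSq (B - Z) + lam * g Z := by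
  obtain ⟨D, rfl⟩ : ∃ D, A = Z + D := ⟨A - Z, by abel⟩
  rw [h.eq_inv_mul_iff hlam] at hA
  -- The step equation says that the residual `B - A` is `lam • W Z * A`. Expanding `‖B - Z‖²`
  -- around it cancels the linear term of `upper` and leaves a surplus `lam / 2 * ⟨W Z * D, D⟩ ≥ 0`.
  have hB : B - (Z + D) = (lam : ℂ) • (W Z * Z) + (lam : ℂ) • (W Z * D) := by
    rw [← hA]
    simp only [Matrix.add_mul, Matrix.mul_add, Matrix.smul_mul, Matrix.one_mul]
    abel
  have hf := frobeniusSq_add (B - (Z + D)) D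
  rw [show B - (Z + D) + D = B - Z by abel] at hf
  have hin : reInner (B - (Z + D)) D = lam * reInner (W Z * Z) D + lam * reInner (W Z * D) D := by
    rw [hB, reInner_add_left, reInner_smul_left, reInner_smul_left]
  have h1 := mul_le_mul_of_nonneg_left (h.upper Z D) hlam
  have h2 := mul_nonneg hlam (reInner_mul_self_nonneg (h.posSemidef Z) D)
  rw [show Z + D - Z = D by abel]
  rw [hin] at hf
  linarith

/-- At each point `g` is squeezed between its affine minorant and its quadratic majorant; no
continuity of `W` is needed. -/
theorem continuous (h : IsReweightable g W c) : Continuous g := by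
  refine continuous_iff_continuousAt.mpr fun Z => ?_
  have hD : Tendsto (fun A : Matrix (Fin M) (Fin T) ℂ => A - Z) (𝓝 Z) (𝓝 0) := by
    simpa using (continuous_sub_right Z).tendsto Z
  have hW : ∀ A : Matrix (Fin M) (Fin T) ℂ,
      Tendsto (fun D => reInner A D) (𝓝 0) (𝓝 0) := fun A => by
    simpa [reInner, Function.comp_def] using
      (continuous_reInner.comp (Continuous.prodMk_right A)).tendsto (0 : Matrix (Fin M) (Fin T) ℂ)
  have hQ : Tendsto (fun D : Matrix (Fin M) (Fin T) ℂ => reInner (W Z * D) D) (𝓝 0) (𝓝 0) := by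
    have : Continuous fun D : Matrix (Fin M) (Fin T) ℂ => reInner (W Z * D) D := by
      unfold reInner
      fun_prop
    simpa [reInner] using this.tendsto 0
  have h1 := ((hW (W Z * Z)).comp hD).const_add (g Z)
  have h2 := h1.add (((hQ.comp hD)).const_mul (1 / 2))
  simp only [mul_zero, add_zero, Function.comp_def] at h1 h2
  refine tendsto_of_tendsto_of_tendsto_of_le_of_le h1 h2 (fun A => ?_) fun A => ?_
  · simpa using h.lower Z (A - Z)
  · simpa using h.upper Z (A - Z)

/-- The subgradient inequality passes to limit points of the reweighting steps. -/
theorem subgradient_of_tendsto (h : IsReweightable g W c) (hlam : 0 ≤ lam) {ι : Type*}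
    {l : Filter ι} [l.NeBot] {Z A B : ι → Matrix (Fin M) (Fin T) ℂ}
    (hA : ∀ k, A k = (1 + (lam : ℂ) • W (Z k))⁻¹ * B k)
    {Zs Bs : Matrix (Fin M) (Fin T) ℂ} (hZl : Tendsto Z l (𝓝 Zs)) (hAl : Tendsto A l (𝓝 Zs))
    (hBl : Tendsto B l (𝓝 Bs)) (D : Matrix (Fin M) (Fin T) ℂ) :
    lam * g Zs + reInner (Bs - Zs) D ≤ lam * g (Zs + D) := by
  have hAZ : Tendsto (fun k => A k - Z k) l (𝓝 0) := by simpa using hAl.sub hZl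
  have hWD : Tendsto (fun k => W (Z k) * (A k - Z k)) l (𝓝 0) := by
    apply tendsto_zero_of_frobeniusSq
    refine squeeze_zero (fun k => frobeniusSq_nonneg _) (fun k => h.bound _ _) ?_
    have := ((continuous_frobeniusSq.tendsto _).comp hAZ).const_mul c
    simpa [frobeniusSq] using this
  -- By the step equation this is the gradient `lam • W (Z k) * Z k`, written so that its limit is
  -- visible.
  have hgrad : Tendsto (fun k => B k - A k - (lam : ℂ) • (W (Z k) * (A k - Z k))) l
      (𝓝 (Bs - Zs)) := by
    simpa using (hBl.sub hAl).sub (hWD.const_smul (lam : ℂ))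
  have hdir : Tendsto (fun k => Zs + D - Z k) l (𝓝 D) := by
    simpa using (tendsto_const_nhds (x := Zs + D)).sub hZl
  have hlim := (((h.continuous.tendsto Zs).comp hZl).const_mul lam).add
    ((continuous_reInner.tendsto (Bs - Zs, D)).comp (hgrad.prodMk_nhds hdir))
  refine le_of_tendsto hlim (Eventually.of_forall fun k => ?_)
  have h1 := mul_le_mul_of_nonneg_left (h.lower (Z k) (Zs + D - Z k)) hlam
  have h2 : B k - A k - (lam : ℂ) • (W (Z k) * (A k - Z k)) = (lam : ℂ) • (W (Z k) * Z k) := by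
    rw [← (h.eq_inv_mul_iff hlam).mp (hA k)]
    simp only [Matrix.add_mul, Matrix.mul_sub, Matrix.smul_mul, Matrix.one_mul, smul_sub]
    abel
  simp only [Function.comp_apply, h2, reInner_smul_left]
  rw [add_sub_cancel] at h1
  linarith

/-- A subgradient of `lam * g` is its gradient. -/
theorem eq_of_subgradient (h : IsReweightable g W c) (hlam : 0 ≤ lam)
    {Z G : Matrix (Fin M) (Fin T) ℂ}
    (hG : ∀ D, lam * g Z + reInner G D ≤ lam * g (Z + D)) :
    (lam : ℂ) • (W Z * Z) = G := by
  -- The constant comes from `½⟨W D, D⟩ ≤ ¼(‖W D‖² + ‖D‖²) ≤ (c + 1)/4 * ‖D‖²`.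
  refine (sub_eq_zero.mp (eq_zero_of_reInner_le (c := lam * (c + 1) / 4) fun D => ?_)).symm
  have h1 := mul_le_mul_of_nonneg_left (h.upper Z D) hlam
  have h2 := mul_le_mul_of_nonneg_left (two_mul_reInner_le (W Z * D) D) hlam
  have h3 := mul_le_mul_of_nonneg_left (h.bound Z D) hlam
  rw [reInner_sub_left, reInner_smul_left]
  linarith [hG D]

end IsReweightable

end NoisyIRLS

/-! ### The smoothed nuclear norm. -/

namespace NoisyIRLS

open scoped ComplexOrder MatrixOrder

variable {M T : ℕ}

section Spectral

variable {n : Type*} [Fintype n] [DecidableEq n] {A : Matrix n n ℂ}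

theorem continuousOn_spectrum (f : ℝ → ℝ) : ContinuousOn f (spectrum ℝ A) :=
  (Matrix.finite_real_spectrum (A := A)).continuousOn f

theorem pos_of_mem_spectrum (hA : A.PosDef) {x : ℝ} (hx : x ∈ spectrum ℝ A) : 0 < x := by
  rw [hA.1.spectrum_real_eq_range_eigenvalues] at hx
  obtain ⟨i, rfl⟩ := hx
  exact hA.eigenvalues_pos i

theorem posSemidef_cfc_rpow (hA : A.PosDef) (s : ℝ) :
    (cfc (fun x : ℝ => x ^ s) A).PosSemidef := by
  rw [← Matrix.nonneg_iff_posSemidef]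
  exact cfc_nonneg fun x hx => Real.rpow_nonneg (pos_of_mem_spectrum hA hx).le s

theorem cfc_rpow_mul_cfc_sqrt (hA : A.PosDef) :
    cfc (fun x : ℝ => x ^ (-(1 / 2) : ℝ)) A * cfc Real.sqrt A = 1 := by
  have hA' : IsSelfAdjoint A := hA.1
  rw [← cfc_mul _ _ A (continuousOn_spectrum _) (continuousOn_spectrum _),
    ← cfc_const_one ℝ A]
  refine cfc_congr fun x hx => ?_
  have hx := pos_of_mem_spectrum hA hx
  simp only [Real.sqrt_eq_rpow]
  rw [← Real.rpow_add hx]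
  norm_num

theorem cfc_sqrt_mul_self (hA : A.PosDef) : cfc Real.sqrt A * cfc Real.sqrt A = A := by
  have hA' : IsSelfAdjoint A := hA.1
  rw [← cfc_mul _ _ A (continuousOn_spectrum _) (continuousOn_spectrum _)]
  conv_rhs => rw [← cfc_id' ℝ A]
  exact cfc_congr fun x hx => Real.mul_self_sqrt (pos_of_mem_spectrum hA hx).le

theorem isHermitian_cfc_sqrt : (cfc Real.sqrt A).IsHermitian :=
  cfc_predicate Real.sqrt A

theorem re_trace_cfc (hA : A.IsHermitian) (f : ℝ → ℝ) :
    (cfc f A).trace.re = ∑ i, f (hA.eigenvalues i) := by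
  rw [hA.cfc_eq, Matrix.IsHermitian.cfc, Unitary.conjStarAlgAut_apply, Matrix.trace_mul_cycle,
    Unitary.coe_star_mul_self, Matrix.one_mul]
  simp [Matrix.trace]

end Spectral

/-- The Gram matrix `Z Zᴴ + μ² I`. -/
def gram (μ : ℝ) (Z : Matrix (Fin M) (Fin T) ℂ) : Matrix (Fin M) (Fin M) ℂ :=
  Z * Zᴴ + ((μ : ℂ) ^ 2) • (1 : Matrix (Fin M) (Fin M) ℂ)

/-- The positive square root of the Gram matrix. -/
noncomputable def gramSqrt (μ : ℝ) (Z : Matrix (Fin M) (Fin T) ℂ) : Matrix (Fin M) (Fin M) ℂ :=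
  cfc Real.sqrt (gram μ Z)

theorem augId_mul_conjTranspose (μ : ℝ) (Z Z' : Matrix (Fin M) (Fin T) ℂ) :
    augId μ Z * (augId μ Z')ᴴ = Z * Z'ᴴ + ((μ : ℂ) ^ 2) • 1 := by
  simp [augId, Matrix.conjTranspose_fromCols_eq_fromRows_conjTranspose, Matrix.fromCols_mul_fromRows,
    sq, smul_smul]
  rw [← Complex.ofReal_mul, Complex.coe_smul]

theorem posDef_gram {μ : ℝ} (hμ : μ ≠ 0) (Z : Matrix (Fin M) (Fin T) ℂ) : (gram μ Z).PosDef := by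
  refine Matrix.PosDef.posSemidef_add (Matrix.posSemidef_self_mul_conjTranspose Z)
    (Matrix.PosDef.one.smul ?_)
  exact_mod_cast (by positivity : 0 < μ ^ 2)

theorem posSemidef_weightP {μ : ℝ} (hμ : μ ≠ 0) (Z : Matrix (Fin M) (Fin T) ℂ) :
    (weightP μ Z).PosSemidef :=
  posSemidef_cfc_rpow (posDef_gram hμ Z) _

theorem weightP_mul_gramSqrt {μ : ℝ} (hμ : μ ≠ 0) (Z : Matrix (Fin M) (Fin T) ℂ) :
    weightP μ Z * gramSqrt μ Z = 1 :=
  cfc_rpow_mul_cfc_sqrt (posDef_gram hμ Z)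

theorem gramSqrt_mul_weightP {μ : ℝ} (hμ : μ ≠ 0) (Z : Matrix (Fin M) (Fin T) ℂ) :
    gramSqrt μ Z * weightP μ Z = 1 :=
  mul_eq_one_comm.mp (weightP_mul_gramSqrt hμ Z)

theorem gramSqrt_mul_self {μ : ℝ} (hμ : μ ≠ 0) (Z : Matrix (Fin M) (Fin T) ℂ) :
    gramSqrt μ Z * gramSqrt μ Z = gram μ Z :=
  cfc_sqrt_mul_self (posDef_gram hμ Z)

theorem weightP_mul_gram {μ : ℝ} (hμ : μ ≠ 0) (Z : Matrix (Fin M) (Fin T) ℂ) :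
    weightP μ Z * gram μ Z = gramSqrt μ Z := by
  rw [← gramSqrt_mul_self hμ, ← Matrix.mul_assoc, weightP_mul_gramSqrt hμ, Matrix.one_mul]

theorem nuclearNorm_augId (μ : ℝ) (Z : Matrix (Fin M) (Fin T) ℂ) :
    nuclearNorm (augId μ Z) = (gramSqrt μ Z).trace.re := by
  rw [nuclearNorm, ← re_trace_cfc, augId_mul_conjTranspose]
  rfl

/-- Linearization of the square root from above. -/
theorem two_mul_trace_gramSqrt_le {μ : ℝ} (hμ : μ ≠ 0) (Z Z' : Matrix (Fin M) (Fin T) ℂ) :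
    2 * (gramSqrt μ Z').trace.re ≤
      (weightP μ Z * gram μ Z').trace.re + (gramSqrt μ Z).trace.re := by
  set S := gramSqrt μ Z with hS
  set R := gramSqrt μ Z' with hR
  set P := weightP μ Z
  have hPS : P * S = 1 := weightP_mul_gramSqrt hμ Z
  have hSP : S * P = 1 := gramSqrt_mul_weightP hμ Z
  have hRR : R * R = gram μ Z' := gramSqrt_mul_self hμ Z'
  have hh : (R - S)ᴴ = R - S :=
    (isHermitian_cfc_sqrt.sub isHermitian_cfc_sqrt : (R - S).IsHermitian)
  -- Matrix form of `(r - s)² / s ≥ 0`, that is `2r ≤ r² / s + s`, with `P = S⁻¹`.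
  have h := reInner_mul_self_nonneg (posSemidef_weightP hμ Z) (R - S)
  have e : P * (R - S) * (R - S) = P * gram μ Z' - P * R * S - R + S := by
    rw [← hRR]
    simp only [Matrix.mul_sub, Matrix.sub_mul, hPS, Matrix.one_mul, Matrix.mul_assoc]
    abel
  have t : (P * R * S).trace = R.trace := by
    rw [Matrix.trace_mul_comm, ← Matrix.mul_assoc, hSP, Matrix.one_mul]
  rw [reInner, hh, e] at h
  simp only [Matrix.trace_add, Matrix.trace_sub, t, Complex.add_re, Complex.sub_re] at h
  linarith

/-- Duality between the nuclear norm and the operator norm. -/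
theorem trace_weightP_mul_le {μ : ℝ} (hμ : μ ≠ 0) (Z Z' : Matrix (Fin M) (Fin T) ℂ) :
    (weightP μ Z * (augId μ Z * (augId μ Z')ᴴ)).trace.re ≤ (gramSqrt μ Z').trace.re := by
  set X := augId μ Z
  set X' := augId μ Z'
  set R := gramSqrt μ Z'
  set P := weightP μ Z
  set P' := weightP μ Z'
  have hX : X * Xᴴ = gram μ Z := augId_mul_conjTranspose μ Z Z
  have hX' : X' * X'ᴴ = gram μ Z' := augId_mul_conjTranspose μ Z' Z'
  have hRh : Rᴴ = R := isHermitian_cfc_sqrt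
  have hPh : Pᴴ = P := (posSemidef_weightP hμ Z).1
  have hPR : P' * R = 1 := weightP_mul_gramSqrt hμ Z'
  have hRP : R * P' = 1 := gramSqrt_mul_weightP hμ Z'
  have hPA : P' * gram μ Z' = R := weightP_mul_gram hμ Z'
  have hPAP : P * (gram μ Z * P) = 1 := by
    rw [← Matrix.mul_assoc, weightP_mul_gram hμ, gramSqrt_mul_weightP hμ]
  -- Complete the square: `P * X` has orthonormal rows and `P' = R⁻¹`, so both square terms have
  -- trace `tr R` and the cross terms give twice the pairing.
  have h := reInner_mul_self_nonneg (posSemidef_weightP hμ Z') (X' - R * (P * X))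
  have e : P' * (X' - R * (P * X)) * (X' - R * (P * X))ᴴ
      = R - P' * (X' * (Xᴴ * P)) * R - P * (X * X'ᴴ) + R := by
    have e1 : P' * (X' - R * (P * X)) = P' * X' - P * X := by
      rw [Matrix.mul_sub, ← Matrix.mul_assoc P' R, hPR, Matrix.one_mul]
    have e2 : (X' - R * (P * X))ᴴ = X'ᴴ - Xᴴ * (P * R) := by
      rw [Matrix.conjTranspose_sub, Matrix.conjTranspose_mul, Matrix.conjTranspose_mul, hRh, hPh,
        Matrix.mul_assoc]
    have e3 : P * X * (Xᴴ * (P * R)) = R := by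
      rw [Matrix.mul_assoc, ← Matrix.mul_assoc X, hX, ← Matrix.mul_assoc (gram μ Z),
        ← Matrix.mul_assoc, hPAP, Matrix.one_mul]
    rw [e1, e2, Matrix.sub_mul, Matrix.mul_sub, Matrix.mul_sub, e3, Matrix.mul_assoc P' X' X'ᴴ,
      hX', hPA]
    simp only [Matrix.mul_assoc]
    abel
  have t : (P' * (X' * (Xᴴ * P)) * R).trace.re = (P * (X * X'ᴴ)).trace.re := by
    rw [Matrix.trace_mul_comm, ← Matrix.mul_assoc, hRP, Matrix.one_mul]
    have : X' * (Xᴴ * P) = (P * (X * X'ᴴ))ᴴ := by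
      simp only [Matrix.conjTranspose_mul, Matrix.conjTranspose_conjTranspose, hPh,
        Matrix.mul_assoc]
    rw [this, Matrix.trace_conjTranspose]
    simp
  rw [reInner, e] at h
  simp only [Matrix.trace_add, Matrix.trace_sub, t, Complex.add_re, Complex.sub_re] at h
  linarith

theorem isReweightable_nuclearNorm {μ : ℝ} (hμ : μ ≠ 0) :
    IsReweightable (fun Z : Matrix (Fin M) (Fin T) ℂ => nuclearNorm (augId μ Z)) (weightP μ)
      (1 / μ ^ 2) where
  nonneg Z := Finset.sum_nonneg fun _ _ => Real.sqrt_nonneg _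
  posSemidef := posSemidef_weightP hμ
  lower Z D := by
    have h := trace_weightP_mul_le hμ Z (Z + D)
    rw [augId_mul_conjTranspose, show Z * (Z + D)ᴴ + ((μ : ℂ) ^ 2) • 1 = gram μ Z + Z * Dᴴ by
      rw [gram, Matrix.conjTranspose_add, Matrix.mul_add]; abel, Matrix.mul_add,
      weightP_mul_gram hμ, ← Matrix.mul_assoc, Matrix.trace_add, Complex.add_re] at h
    simpa only [nuclearNorm_augId, reInner] using h
  upper Z D := by
    have h := two_mul_trace_gramSqrt_le hμ Z (Z + D)
    have e : gram μ (Z + D) = gram μ Z + Z * Dᴴ + D * Zᴴ + D * Dᴴ := by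
      simp only [gram, Matrix.conjTranspose_add, Matrix.mul_add, Matrix.add_mul]
      abel
    have hs : reInner (weightP μ Z * D) Z = reInner (weightP μ Z * Z) D := by
      rw [reInner_mul_left, (posSemidef_weightP hμ Z).1.eq, reInner_comm]
    simp only [e, Matrix.mul_add, weightP_mul_gram hμ, ← Matrix.mul_assoc, Matrix.trace_add,
      Complex.add_re] at h
    change 2 * _ ≤ _ + reInner (weightP μ Z * Z) D + reInner (weightP μ Z * D) Z
      + reInner (weightP μ Z * D) D + _ at h
    rw [hs] at h
    simp only [nuclearNorm_augId]
    linarith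
  bound Z D := by
    have hPh := (posSemidef_weightP hμ Z).1.eq
    -- Since `P G P = 1`, `‖D‖² = ⟨G E, E⟩` with `E = P D`, and `G` dominates `μ²`.
    have e : D = weightP μ Z * (gram μ Z * (weightP μ Z * D)) := by
      rw [← Matrix.mul_assoc, weightP_mul_gram hμ, ← Matrix.mul_assoc, gramSqrt_mul_weightP hμ,
        Matrix.one_mul]
    have h : frobeniusSq D = frobeniusSq (Zᴴ * (weightP μ Z * D))
        + μ ^ 2 * frobeniusSq (weightP μ Z * D) := by
      set E := weightP μ Z * D with hE
      rw [← reInner_self D]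
      nth_rw 1 [e]
      rw [reInner_mul_left, hPh, ← hE, gram, Matrix.add_mul, reInner_add_left, Matrix.mul_assoc,
        reInner_mul_left Z, Matrix.smul_mul, Matrix.one_mul, ← Complex.ofReal_pow,
        reInner_smul_left, reInner_self, reInner_self]
    have hμ2 : 0 < μ ^ 2 := by positivity
    rw [one_div_mul_eq_div, le_div_iff₀ hμ2]
    linarith [frobeniusSq_nonneg (Zᴴ * (weightP μ Z * D))]

end NoisyIRLS

/-! ### The smoothed row norm. -/

namespace NoisyIRLS

open scoped ComplexOrder

variable {M T : ℕ}

theorem rowNorm_augOnes (μ : ℝ) (V : Matrix (Fin M) (Fin T) ℂ) (i : Fin M) :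
    rowNorm (augOnes μ V) i = √(rowNorm V i ^ 2 + μ ^ 2) := by
  rw [rowNorm, rowNorm, Real.sq_sqrt (Finset.sum_nonneg fun _ _ => by positivity)]
  simp [augOnes]

/-- The real inner product of the `i`-th rows. -/
def rowInner (A B : Matrix (Fin M) (Fin T) ℂ) (i : Fin M) : ℝ :=
  ∑ j, ((A i j).re * (B i j).re + (A i j).im * (B i j).im)

theorem rowNorm_sq (A : Matrix (Fin M) (Fin T) ℂ) (i : Fin M) :
    rowNorm A i ^ 2 = rowInner A A i := by
  rw [rowNorm, Real.sq_sqrt (Finset.sum_nonneg fun _ _ => by positivity), rowInner]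
  simp only [Complex.sq_norm, Complex.normSq_apply]

theorem reInner_weightQ_mul (μ : ℝ) (V A B : Matrix (Fin M) (Fin T) ℂ) :
    reInner (weightQ μ V * A) B =
      ∑ i, rowInner A B i / √(rowNorm V i ^ 2 + μ ^ 2) := by
  rw [reInner_eq_sum]
  refine Finset.sum_congr rfl fun i _ => ?_
  rw [rowInner, Finset.sum_div]
  refine Finset.sum_congr rfl fun j _ => ?_
  simp only [weightQ, Matrix.diagonal_mul, Complex.re_ofReal_mul, Complex.im_ofReal_mul]
  ring

theorem rowInner_add_add (A B : Matrix (Fin M) (Fin T) ℂ) (i : Fin M) :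
    rowInner (A + B) (A + B) i = rowInner A A i + 2 * rowInner A B i + rowInner B B i := by
  simp only [rowInner, Finset.mul_sum, ← Finset.sum_add_distrib, Matrix.add_apply,
    Complex.add_re, Complex.add_im]
  exact Finset.sum_congr rfl fun j _ => by ring

theorem rowInner_sq_le (A B : Matrix (Fin M) (Fin T) ℂ) (i : Fin M) :
    rowInner A B i ^ 2 ≤ rowInner A A i * rowInner B B i := by
  have h := discrim_le_zero (a := rowInner B B i) (b := 2 * rowInner A B i)
    (c := rowInner A A i) fun t => ?_
  · rw [discrim] at h
    linarith
  · have : rowInner B B i * (t * t) + 2 * rowInner A B i * t + rowInner A A i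
        = ∑ j, (((A i j).re + t * (B i j).re) ^ 2 + ((A i j).im + t * (B i j).im) ^ 2) := by
      simp only [rowInner, Finset.mul_sum, Finset.sum_mul, ← Finset.sum_add_distrib]
      exact Finset.sum_congr rfl fun j _ => by ring
    rw [this]
    exact Finset.sum_nonneg fun _ _ => by positivity

/-- With `s = √(a + μ²)`, squaring the left side leaves the excess `b² / s²`, at most `d` by
Cauchy–Schwarz. This is the tangent bound for one row. -/
theorem add_div_sqrt_le_sqrt {μ a b d : ℝ} (hμ : μ ≠ 0) (ha : 0 ≤ a) (hd : 0 ≤ d)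
    (hb : b ^ 2 ≤ a * d) : √(a + μ ^ 2) + b / √(a + μ ^ 2) ≤ √(a + 2 * b + d + μ ^ 2) := by
  have hμ2 : 0 < μ ^ 2 := by positivity
  have hs : 0 < √(a + μ ^ 2) := Real.sqrt_pos.mpr (by linarith)
  have hs2 := Real.sq_sqrt (show 0 ≤ a + μ ^ 2 by linarith)
  apply Real.le_sqrt_of_sq_le
  have h1 : b ^ 2 / √(a + μ ^ 2) ^ 2 ≤ d := by
    rw [div_le_iff₀ (by positivity), hs2]
    nlinarith
  have h2 : (√(a + μ ^ 2) + b / √(a + μ ^ 2)) ^ 2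
      = √(a + μ ^ 2) ^ 2 + 2 * b + b ^ 2 / √(a + μ ^ 2) ^ 2 := by
    field_simp
    ring
  rw [h2]
  linarith

/-- The inequality `2rs ≤ r² + s²`, divided by `2s`, for the new and old values `r` and `s` of the
smoothed norm of one row. -/
theorem sqrt_le_add_div_sqrt {μ a b d : ℝ} (hμ : μ ≠ 0) (ha : 0 ≤ a)
    (h : 0 ≤ a + 2 * b + d) :
    √(a + 2 * b + d + μ ^ 2)
      ≤ √(a + μ ^ 2) + b / √(a + μ ^ 2) + 1 / 2 * (d / √(a + μ ^ 2)) := by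
  have hμ2 : 0 < μ ^ 2 := by positivity
  have hs : 0 < √(a + μ ^ 2) := Real.sqrt_pos.mpr (by linarith)
  have hs2 := Real.sq_sqrt (show 0 ≤ a + μ ^ 2 by linarith)
  have hr2 := Real.sq_sqrt (show 0 ≤ a + 2 * b + d + μ ^ 2 by linarith)
  have e : √(a + μ ^ 2) + b / √(a + μ ^ 2) + 1 / 2 * (d / √(a + μ ^ 2))
      = (2 * √(a + μ ^ 2) ^ 2 + 2 * b + d) / (2 * √(a + μ ^ 2)) := by
    field_simp
  rw [e, le_div_iff₀ (by positivity)]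
  nlinarith [sq_nonneg (√(a + 2 * b + d + μ ^ 2) - √(a + μ ^ 2))]

theorem isReweightable_l21Norm {μ : ℝ} (hμ : μ ≠ 0) :
    IsReweightable (fun V : Matrix (Fin M) (Fin T) ℂ => l21Norm (augOnes μ V)) (weightQ μ)
      (1 / μ ^ 2) where
  nonneg V := Finset.sum_nonneg fun _ _ => Real.sqrt_nonneg _
  posSemidef V := Matrix.PosSemidef.diagonal fun i => by
    simp only [Pi.zero_apply]
    exact Complex.zero_le_real.mpr (by positivity)
  lower V D := by
    simp only [l21Norm, reInner_weightQ_mul, rowNorm_augOnes, ← Finset.sum_add_distrib,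
      rowNorm_sq, rowInner_add_add]
    refine Finset.sum_le_sum fun i _ => add_div_sqrt_le_sqrt hμ ?_ ?_ (rowInner_sq_le V D i) <;>
    · rw [← rowNorm_sq]
      positivity
  upper V D := by
    simp only [l21Norm, reInner_weightQ_mul, rowNorm_augOnes, ← Finset.sum_add_distrib,
      rowNorm_sq, rowInner_add_add, Finset.mul_sum]
    refine Finset.sum_le_sum fun i _ => sqrt_le_add_div_sqrt hμ ?_ ?_
    · rw [← rowNorm_sq]
      positivity
    · rw [← rowInner_add_add, ← rowNorm_sq]
      positivity
  bound V D := by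
    simp only [frobeniusSq, Finset.mul_sum]
    refine Finset.sum_le_sum fun i _ => Finset.sum_le_sum fun j _ => ?_
    have hμ2 : 0 < μ ^ 2 := by positivity
    have h : 0 ≤ rowNorm V i ^ 2 := by positivity
    simp only [weightQ, Matrix.diagonal_mul, norm_mul, mul_pow, Complex.norm_real,
      Real.norm_eq_abs, sq_abs, div_pow, one_pow]
    rw [Real.sq_sqrt (by linarith)]
    gcongr
    linarith

end NoisyIRLS

/-! ### Convergence of the iteration and optimality of limit points. -/

namespace NoisyIRLS

variable {M T : ℕ} {Y : Matrix (Fin M) (Fin T) ℂ} {lam₁ lam₂ μ : ℝ}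
  {Z V : ℕ → Matrix (Fin M) (Fin T) ℂ}

theorem IsIRLSSequence.objective_descent (hZV : IsIRLSSequence Y lam₁ lam₂ μ Z V)
    (hlam₁ : 0 ≤ lam₁) (hlam₂ : 0 ≤ lam₂) (hμ : μ ≠ 0) (k : ℕ) :
    objective Y lam₁ lam₂ μ (Z (k + 1), V (k + 1)) + 1 / 2 * frobeniusSq (Z (k + 1) - Z k)
      + 1 / 2 * frobeniusSq (V (k + 1) - V k) ≤ objective Y lam₁ lam₂ μ (Z k, V k) := by
  have h1 := (isReweightable_nuclearNorm hμ).descent hlam₁ (hZV k).1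
  have h2 := (isReweightable_l21Norm hμ).descent hlam₂ (hZV k).2
  rw [sub_right_comm Y (V k), sub_right_comm Y (V k)] at h1
  simp only [objective]
  linarith

theorem objective_nonneg (hlam₁ : 0 ≤ lam₁) (hlam₂ : 0 ≤ lam₂) (hμ : μ ≠ 0)
    (W : Matrix (Fin M) (Fin T) ℂ × Matrix (Fin M) (Fin T) ℂ) :
    0 ≤ objective Y lam₁ lam₂ μ W := by
  have h1 := mul_nonneg hlam₁ ((isReweightable_nuclearNorm hμ).nonneg W.1)
  have h2 := mul_nonneg hlam₂ ((isReweightable_l21Norm hμ).nonneg W.2)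
  have h3 := frobeniusSq_nonneg (Y - W.1 - W.2)
  simp only [objective]
  linarith

/-- The objective values decrease and are bounded below, so consecutive differences, which dominate
the squared steps, vanish. -/
theorem IsIRLSSequence.tendsto_step (hZV : IsIRLSSequence Y lam₁ lam₂ μ Z V)
    (hlam₁ : 0 ≤ lam₁) (hlam₂ : 0 ≤ lam₂) (hμ : μ ≠ 0) :
    Tendsto (fun k => Z (k + 1) - Z k) atTop (𝓝 0) ∧
      Tendsto (fun k => V (k + 1) - V k) atTop (𝓝 0) := by
  have hd := hZV.objective_descent hlam₁ hlam₂ hμ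
  have hanti : Antitone fun k => objective Y lam₁ lam₂ μ (Z k, V k) :=
    antitone_nat_of_succ_le fun k => by
      linarith [hd k, frobeniusSq_nonneg (Z (k + 1) - Z k), frobeniusSq_nonneg (V (k + 1) - V k)]
  have hlim := tendsto_atTop_ciInf hanti
    ⟨0, Set.forall_mem_range.mpr fun k => objective_nonneg hlam₁ hlam₂ hμ _⟩
  have hdiff := (hlim.sub (hlim.comp (tendsto_add_atTop_nat 1))).const_mul 2
  simp only [sub_self, mul_zero, Function.comp_apply] at hdiff
  constructor <;>
  · refine tendsto_zero_of_frobeniusSq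
      (squeeze_zero (fun k => frobeniusSq_nonneg _) (fun k => ?_) hdiff)
    linarith [hd k, frobeniusSq_nonneg (Z (k + 1) - Z k), frobeniusSq_nonneg (V (k + 1) - V k)]

/-- Adding both subgradient inequalities to the expansion of the data term cancels all linear terms
and leaves a square. -/
theorem objective_le_of_subgradient {Zs Vs : Matrix (Fin M) (Fin T) ℂ}
    (hZ : ∀ D, lam₁ * nuclearNorm (augId μ Zs) + reInner (Y - Zs - Vs) D
      ≤ lam₁ * nuclearNorm (augId μ (Zs + D)))
    (hV : ∀ D, lam₂ * l21Norm (augOnes μ Vs) + reInner (Y - Zs - Vs) D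
      ≤ lam₂ * l21Norm (augOnes μ (Vs + D)))
    (W : Matrix (Fin M) (Fin T) ℂ × Matrix (Fin M) (Fin T) ℂ) :
    objective Y lam₁ lam₂ μ (Zs, Vs) ≤ objective Y lam₁ lam₂ μ W := by
  have h1 := hZ (W.1 - Zs)
  have h2 := hV (W.2 - Vs)
  have h4 := frobeniusSq_add (Y - Zs - Vs) (-((W.1 - Zs) + (W.2 - Vs)))
  rw [show Y - Zs - Vs + -((W.1 - Zs) + (W.2 - Vs)) = Y - W.1 - W.2 by abel, frobeniusSq_neg,
    reInner_neg_right, reInner_add_right] at h4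
  have h5 := frobeniusSq_nonneg ((W.1 - Zs) + (W.2 - Vs))
  rw [add_sub_cancel] at h1 h2
  simp only [objective]
  linarith

/-- By KKT the linear terms cancel. The summand `1` absorbs `½‖D + E‖²`; the rest generously covers
the two Hessian terms. -/
theorem objective_add_le (hlam₁ : 0 ≤ lam₁) (hlam₂ : 0 ≤ lam₂) (hμ : μ ≠ 0)
    {Zs Vs : Matrix (Fin M) (Fin T) ℂ}
    (hZ : (lam₁ : ℂ) • (weightP μ Zs * Zs) = Y - Zs - Vs)
    (hV : (lam₂ : ℂ) • (weightQ μ Vs * Vs) = Y - Zs - Vs) (D E : Matrix (Fin M) (Fin T) ℂ) :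
    objective Y lam₁ lam₂ μ (Zs + D, Vs + E) ≤ objective Y lam₁ lam₂ μ (Zs, Vs)
      + (1 + (lam₁ + lam₂) * (1 / μ ^ 2 + 1)) * (frobeniusSq D + frobeniusSq E) := by
  have h1 := (isReweightable_nuclearNorm hμ).upper Zs D
  have h2 := (isReweightable_l21Norm hμ).upper Vs E
  have b1 := (isReweightable_nuclearNorm hμ).bound Zs D
  have b2 := (isReweightable_l21Norm hμ).bound Vs E
  have c1 := two_mul_reInner_le (weightP μ Zs * D) D
  have c2 := two_mul_reInner_le (weightQ μ Vs * E) E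
  have c3 := two_mul_reInner_le D E
  have h3 := frobeniusSq_add (Y - Zs - Vs) (-(D + E))
  rw [show Y - Zs - Vs + -(D + E) = Y - (Zs + D) - (Vs + E) by abel, frobeniusSq_neg,
    reInner_neg_right, reInner_add_right, frobeniusSq_add D E] at h3
  have g1 := reInner_smul_left lam₁ (weightP μ Zs * Zs) D
  have g2 := reInner_smul_left lam₂ (weightQ μ Vs * Vs) E
  rw [hZ] at g1
  rw [hV] at g2
  have hD := frobeniusSq_nonneg D
  have hE := frobeniusSq_nonneg E
  have hc : 0 ≤ 1 / μ ^ 2 + 1 := by positivity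
  have u1 : lam₁ * nuclearNorm (augId μ (Zs + D)) ≤ lam₁ * nuclearNorm (augId μ Zs)
      + reInner (Y - Zs - Vs) D + lam₁ * ((1 / μ ^ 2 + 1) * frobeniusSq D) := by
    have := mul_nonneg hc hD
    have h : nuclearNorm (augId μ (Zs + D)) ≤ nuclearNorm (augId μ Zs)
      + reInner (weightP μ Zs * Zs) D + (1 / μ ^ 2 + 1) * frobeniusSq D := by linarith
    linarith [mul_le_mul_of_nonneg_left h hlam₁]
  have u2 : lam₂ * l21Norm (augOnes μ (Vs + E)) ≤ lam₂ * l21Norm (augOnes μ Vs)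
      + reInner (Y - Zs - Vs) E + lam₂ * ((1 / μ ^ 2 + 1) * frobeniusSq E) := by
    have := mul_nonneg hc hE
    have h : l21Norm (augOnes μ (Vs + E)) ≤ l21Norm (augOnes μ Vs)
      + reInner (weightQ μ Vs * Vs) E + (1 / μ ^ 2 + 1) * frobeniusSq E := by linarith
    linarith [mul_le_mul_of_nonneg_left h hlam₂]
  have v1 := mul_nonneg hlam₁ (mul_nonneg hc hE)
  have v2 := mul_nonneg hlam₂ (mul_nonneg hc hD)
  simp only [objective]
  linarith

section Derivative

attribute [local instance] Matrix.normedAddCommGroup Matrix.normedSpace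

/-- The sup norm only measures growth here; the Fréchet derivative depends on the topology alone. -/
theorem frobeniusSq_le_mul_norm_sq (A : Matrix (Fin M) (Fin T) ℂ) :
    frobeniusSq A ≤ M * T * ‖A‖ ^ 2 := by
  have : frobeniusSq A ≤ ∑ _i : Fin M, ∑ _j : Fin T, ‖A‖ ^ 2 := by
    refine Finset.sum_le_sum fun i _ => Finset.sum_le_sum fun j _ => ?_
    gcongr
    exact Matrix.norm_entry_le_entrywise_sup_norm A
  simpa [mul_assoc] using this

/-- A minimizer at which a function grows at most quadratically is a critical point. -/
theorem hasFDerivAt_zero_of_quadratic_bound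
    {f : Matrix (Fin M) (Fin T) ℂ × Matrix (Fin M) (Fin T) ℂ → ℝ}
    {W : Matrix (Fin M) (Fin T) ℂ × Matrix (Fin M) (Fin T) ℂ} {c : ℝ} (hc : 0 ≤ c)
    (hlow : ∀ X, f W ≤ f X)
    (hup : ∀ X, f X ≤ f W + c * (frobeniusSq (X.1 - W.1) + frobeniusSq (X.2 - W.2))) :
    HasFDerivAt (𝕜 := ℝ) f 0 W := by
  have hO : (fun X => f X - f W) =O[𝓝 W] fun X => ‖X - W‖ ^ 2 := by
    refine Asymptotics.IsBigO.of_bound (c * (2 * (M * T))) (Eventually.of_forall fun X => ?_)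
    rw [Real.norm_of_nonneg (sub_nonneg.mpr (hlow X)), Real.norm_of_nonneg (by positivity)]
    have h1 : frobeniusSq (X.1 - W.1) ≤ M * T * ‖X - W‖ ^ 2 :=
      (frobeniusSq_le_mul_norm_sq _).trans (by gcongr; exact norm_fst_le (X - W))
    have h2 : frobeniusSq (X.2 - W.2) ≤ M * T * ‖X - W‖ ^ 2 :=
      (frobeniusSq_le_mul_norm_sq _).trans (by gcongr; exact norm_snd_le (X - W))
    linarith [hup X, mul_le_mul_of_nonneg_left (add_le_add h1 h2) hc]
  have h := (Asymptotics.IsBigO.hasFDerivAt (𝕜 := ℝ) hO one_lt_two).add_const (f W)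
  simp only [sub_add_cancel] at h
  exact h

end Derivative

end NoisyIRLS

theorem mainTheorem6 (M T : ℕ) (Y : Matrix (Fin M) (Fin T) ℂ) (lam₁ lam₂ μ : ℝ)
    (hlam₁ : 0 ≤ lam₁) (hlam₂ : 0 ≤ lam₂) (hμ : μ ≠ 0)
    (Z V : ℕ → Matrix (Fin M) (Fin T) ℂ)
    (hZV : NoisyIRLS.IsIRLSSequence Y lam₁ lam₂ μ Z V)
    (Zs Vs : Matrix (Fin M) (Fin T) ℂ)
    (hlim : MapClusterPt (Zs, Vs) atTop (fun k => (Z k, V k))) :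
    -- the gradient of the objective vanishes at the limit point
    HasFDerivAt (𝕜 := ℝ) (NoisyIRLS.objective Y lam₁ lam₂ μ) 0 (Zs, Vs) ∧
    -- KKT equations
    (1 + (lam₁ : ℂ) • NoisyIRLS.weightP μ Zs) * Zs - Y + Vs = 0 ∧
    (1 + (lam₂ : ℂ) • NoisyIRLS.weightQ μ Vs) * Vs - Y + Zs = 0 ∧
    -- the same equations in fixed-point form
    Zs = (1 + (lam₁ : ℂ) • NoisyIRLS.weightP μ Zs)⁻¹ * (Y - Vs) ∧
    Vs = (1 + (lam₂ : ℂ) • NoisyIRLS.weightQ μ Vs)⁻¹ * (Y - Zs) ∧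
    -- global optimality
    IsMinOn (NoisyIRLS.objective Y lam₁ lam₂ μ) Set.univ (Zs, Vs) := by
  have hP := NoisyIRLS.isReweightable_nuclearNorm (M := M) (T := T) hμ
  have hQ := NoisyIRLS.isReweightable_l21Norm (M := M) (T := T) hμ
  obtain ⟨hdZ, hdV⟩ := hZV.tendsto_step hlam₁ hlam₂ hμ
  -- The ultrafilter plays the role of the convergent subsequence.
  obtain ⟨U, hU, hUlim⟩ := mapClusterPt_iff_ultrafilter.mp hlim
  have hZl : Tendsto Z U (𝓝 Zs) := (continuous_fst.tendsto _).comp hUlim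
  have hVl : Tendsto V U (𝓝 Vs) := (continuous_snd.tendsto _).comp hUlim
  have hZl' : Tendsto (fun k => Z (k + 1)) U (𝓝 Zs) := by
    simpa using (hdZ.mono_left hU).add hZl
  have hVl' : Tendsto (fun k => V (k + 1)) U (𝓝 Vs) := by
    simpa using (hdV.mono_left hU).add hVl
  have sZ := hP.subgradient_of_tendsto hlam₁ (fun k => (hZV k).1) hZl hZl'
    (tendsto_const_nhds.sub hVl)
  -- The `V` step uses the already updated `Z (k + 1)`, hence `hZl'` for its target.
  have sV := hQ.subgradient_of_tendsto hlam₂ (fun k => (hZV k).2) hVl hVl'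
    (tendsto_const_nhds.sub hZl')
  rw [sub_right_comm Y Vs] at sZ
  have eZ := hP.eq_of_subgradient hlam₁ sZ
  have eV := hQ.eq_of_subgradient hlam₂ sV
  have hmin := NoisyIRLS.objective_le_of_subgradient sZ sV
  have kZ : (1 + (lam₁ : ℂ) • NoisyIRLS.weightP μ Zs) * Zs = Y - Vs := by
    rw [Matrix.add_mul, Matrix.one_mul, Matrix.smul_mul, eZ]
    abel
  have kV : (1 + (lam₂ : ℂ) • NoisyIRLS.weightQ μ Vs) * Vs = Y - Zs := by
    rw [Matrix.add_mul, Matrix.one_mul, Matrix.smul_mul, eV]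
    abel
  refine ⟨NoisyIRLS.hasFDerivAt_zero_of_quadratic_bound
    (c := 1 + (lam₁ + lam₂) * (1 / μ ^ 2 + 1)) (by positivity) hmin fun X => ?_, ?_, ?_,
    (hP.eq_inv_mul_iff hlam₁).mpr kZ, (hQ.eq_inv_mul_iff hlam₂).mpr kV, fun W _ => hmin W⟩
  · simpa using NoisyIRLS.objective_add_le hlam₁ hlam₂ hμ eZ eV (X.1 - Zs) (X.2 - Vs)
  · rw [kZ]
    abel
  · rw [kV]
    abel
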